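/- Let $\alpha > 1/2$ and let $f \in C^{\alpha}(\mathbb{R},\mathbb{R})$ be a periodic function. For a continuous periodic function $g:\mathbb{R}\to\mathbb{R}$ and $x \in \mathbb{R}$ define $$ r_g(x) = \inf\left\{ r \ge 0 : \frac{1}{2r}\int_{x-r}^{x+r} g(z)\,dz = \sup_{s>0} \frac{1}{2s}\int_{x-s}^{x+s} g(z)\,dz \right\}, $$ where for $r = 0$ the average is understood as the point evaluation $g(x)$. Then $$ \left| \bigcup_{x\in\mathbb{R}} \{ r_f(x), r_{-f}(x) \} \right| \le 2 $$ if and only if there are $a,b,c,d \in \mathbb{R}$ such that $f(x) = a + b\sin(cx+d)$ for all $x \in \mathbb{R}$. -/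

import Mathlib

namespace MaximalRigidity

/-- The class `C^α(ℝ, ℝ)` for a real exponent `α ≥ 0`: with `k = ⌊α⌋`, the function is `k` times
continuously differentiable and its `k`-th derivative is Hölder continuous with exponent `α - k`
on every compact set (for integer `α` this last condition is automatic, and the class is the usual
`C^k`). -/
def IsCAlpha (α : ℝ) (f : ℝ → ℝ) : Prop :=
  ContDiff ℝ (⌊α⌋₊ : ℕ∞) f ∧
    ∀ K : Set ℝ, IsCompact K →
      ∃ C : NNReal, HolderOnWith C (α - (⌊α⌋₊ : ℝ)).toNNReal (iteratedDeriv ⌊α⌋₊ f) K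

/-- The average of `f` over the interval `[x - r, x + r]`, understood as the point evaluation
`f x` if `r = 0`. -/
noncomputable def intervalAvg (f : ℝ → ℝ) (x r : ℝ) : ℝ :=
  if r = 0 then f x else (1 / (2 * r)) * ∫ z in (x - r)..(x + r), f z

/-- The length function `r_f(x)`: the smallest radius `r ≥ 0` for which the average of `f` over
`[x - r, x + r]` equals the supremum of all averages over intervals centred at `x`. -/
noncomputable def maxRadius (f : ℝ → ℝ) (x : ℝ) : ℝ :=
  sInf {r : ℝ | 0 ≤ r ∧ intervalAvg f x r = ⨆ s : Set.Ioi (0 : ℝ), intervalAvg f x s}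

end MaximalRigidity

namespace MaximalRigidity

/-! At a maximum point of `f` the radius is 0, so two values in total means that all radii lie in
{0, γ} for one γ > 0. At each x, either one of the two radii is γ, or both are 0 and the average
does not depend on the radius. In every case γ is a local extremum of the average as a function of
the radius, so γ(f(x+γ) + f(x-γ)) = ∫ f over [x-γ, x+γ] for all x.

In Fourier coefficients this kills every frequency ω with sin(ωγ) ≠ ωγ cos(ωγ). The frequencies are
multiples of 2π/T, and `eq_of_sin_eq_mul_cos` shows that at most one positive multiple survives: two
would make both exp(2iβ) and β algebraic, with β = 2πγ/T, against Hermite–Lindemann. Hence `f` is a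
constant plus one sine (`exists_sin_of_critical`).

Conversely, averaging a + b sin(cx+d) multiplies the sine term by sinc(cr). The optimal radius is 0
or the least minimiser of sinc(cr), according to the sign of that term (`maxRadius_sin_mem_pair`).
-/

/-! ### The Hermite–Lindemann theorem. -/

open Polynomial in
theorem isIntegral_pow_mul_aeval {L : Type*} [CommRing L] {D : ℤ} {x : L}
    (hx : IsIntegral ℤ (D • x)) (g : ℤ[X]) {K : ℕ} (hg : g.natDegree ≤ K) :
    IsIntegral ℤ ((D : L) ^ K * aeval x g) := by
  rw [aeval_eq_sum_range' (Nat.lt_succ_of_le hg), Finset.mul_sum]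
  refine IsIntegral.sum _ fun i hi => ?_
  have hi' : i ≤ K := Nat.lt_succ_iff.mp (Finset.mem_range.mp hi)
  have h : (D : L) ^ K * (g.coeff i • x ^ i)
      = ((D ^ (K - i) * g.coeff i : ℤ) : L) * (D • x) ^ i := by
    rw [zsmul_eq_mul, zsmul_eq_mul, mul_pow]
    push_cast
    rw [← Nat.sub_add_cancel hi', pow_add, Nat.add_sub_cancel]
    ring
  rw [h]
  exact IsIntegral.mul (isIntegral_algebraMap (R := ℤ) (A := L)) (hx.pow i)

theorem exists_intCast_eq_of_isIntegral_of_fixed {L : Type*} [Field L] [NumberField L]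
    [IsGalois ℚ L] {x : L} (hx : IsIntegral ℤ x) (hσ : ∀ σ : L ≃ₐ[ℚ] L, σ x = x) :
    ∃ m : ℤ, (m : L) = x := by
  obtain ⟨q, rfl⟩ := (IsGalois.mem_range_algebraMap_iff_fixed x).mpr hσ
  obtain ⟨m, rfl⟩ := IsIntegrallyClosed.isIntegral_iff.mp
    ((isIntegral_algebraMap_iff (algebraMap ℚ L).injective).mp hx)
  exact ⟨m, by simp⟩

open Polynomial in
theorem exists_int_polynomial_vanishing {L : Type*} [Field L] [NumberField L] (S : Finset L)
    (hS : (0 : L) ∉ S) : ∃ f : ℤ[X], f.eval 0 ≠ 0 ∧ ∀ x ∈ S, aeval x f = 0 := by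
  have h : ∀ x : L, ∃ f : ℤ[X], x ≠ 0 → f.eval 0 ≠ 0 ∧ aeval x f = 0 := by
    intro x
    by_cases hx : x = 0
    · exact ⟨0, fun h => absurd hx h⟩
    have hx' : IsAlgebraic ℤ x :=
      (IsFractionRing.isAlgebraic_iff ℤ ℚ L).mpr (Algebra.IsAlgebraic.isAlgebraic x)
    obtain ⟨f, h0, h1⟩ := hx'.exists_nonzero_coeff_and_aeval_eq_zero
      (mem_nonZeroDivisors_of_ne_zero hx)
    exact ⟨f, fun _ => ⟨by rwa [← coeff_zero_eq_eval_zero], h1⟩⟩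
  choose f hf using h
  have hne : ∀ x ∈ S, x ≠ 0 := fun x hx h => hS (h ▸ hx)
  refine ⟨∏ x ∈ S, f x, ?_, fun x hx => ?_⟩
  · rw [eval_prod]
    exact Finset.prod_ne_zero_iff.mpr fun x hx => (hf x (hne x hx)).1
  · rw [map_prod]
    exact Finset.prod_eq_zero hx (hf x (hne x hx)).2

theorem tendsto_mul_pow_div_factorial_pred (B C : ℝ) :
    Filter.Tendsto (fun p : ℕ => B * (C ^ p / (p - 1).factorial)) Filter.atTop (nhds 0) := by
  rw [← Filter.tendsto_add_atTop_iff_nat 1]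
  have h := (FloorSemiring.tendsto_pow_div_factorial_atTop C).const_mul (B * C)
  rw [mul_zero] at h
  refine h.congr fun n => ?_
  simp only [Nat.add_sub_cancel, pow_succ]
  ring

open Polynomial in
/-- A Galois-invariant integer combination of exponentials of algebraic numbers in which `exp 0`
has a nonzero coefficient does not vanish. -/
theorem sum_mul_exp_ne_zero_of_galois_invariant {L : Type*} [Field L] [NumberField L]
    [IsGalois ℚ L] (φ : L →+* ℂ) (H : L →₀ ℤ) (h0 : H 0 ≠ 0)
    (hσ : ∀ (σ : L ≃ₐ[ℚ] L) (x : L), H (σ x) = H x) :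
    (H.sum fun x w => (w : ℂ) * Complex.exp (φ x)) ≠ 0 := by
  classical
  intro hsum
  set S := H.support.erase 0 with hSdef
  obtain ⟨f, hf0, hfS⟩ := exists_int_polynomial_vanishing S (Finset.notMem_erase _ _)
  obtain ⟨D, hD0, hD⟩ := exists_integral_multiples ℤ ℚ S
  obtain ⟨c, hc⟩ := LindemannWeierstrass.exp_polynomial_approx f hf0
  set d := f.natDegree
  set B : ℝ := ∑ x ∈ S, |(H x : ℝ)|
  obtain ⟨p₀, hp₀⟩ := Filter.eventually_atTop.mp
    ((tendsto_mul_pow_div_factorial_pred B (|(D : ℝ)| ^ d * c)).eventually_lt_const one_pos)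
  -- The prime exceeds |D| and |H 0|, so it divides neither, and is large enough to make the total
  -- approximation error less than 1.
  obtain ⟨p, hp, hpp⟩ := Nat.exists_infinite_primes
    (p₀ + (f.eval 0).natAbs + D.natAbs + (H 0).natAbs + 1)
  obtain ⟨n, hn, g, hg, happ⟩ := hc p (by omega) hpp
  set K := p * d
  have hgK : g.natDegree ≤ K := hg.trans (Nat.sub_le _ _)
  have hmemσ : ∀ (σ : L ≃ₐ[ℚ] L) (x : L), x ∈ S ↔ σ x ∈ S := by
    intro σ x
    simp [hSdef, hσ]
  obtain ⟨m, hm⟩ : ∃ m : ℤ, (m : L) = ∑ x ∈ S, (H x : L) * ((D : L) ^ K * aeval x g) := by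
    apply exists_intCast_eq_of_isIntegral_of_fixed
    · exact IsIntegral.sum _ fun x hx => IsIntegral.mul
        (isIntegral_algebraMap (R := ℤ) (A := L)) (isIntegral_pow_mul_aeval (hD x hx) g hgK)
    · intro σ
      rw [map_sum]
      refine Finset.sum_equiv σ.toEquiv (fun x => hmemσ σ x) fun x _ => ?_
      have h : σ (aeval x g) = aeval (σ x) g :=
        (aeval_algHom_apply ((σ : L →ₐ[ℚ] L).restrictScalars ℤ) x g).symm
      simp [hσ, h]
  have hmC : (m : ℂ) = ∑ x ∈ S, (H x : ℂ) * ((D : ℂ) ^ K * aeval (φ x) g) := by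
    rw [← map_intCast φ, hm, map_sum]
    refine Finset.sum_congr rfl fun x _ => ?_
    have h : φ (aeval x g) = aeval (φ x) g :=
      (aeval_algHom_apply φ.toIntAlgHom x g).symm
    simp [h]
  have hsplit : (H 0 : ℂ) + ∑ x ∈ S, (H x : ℂ) * Complex.exp (φ x) = 0 := by
    rw [← hsum, Finsupp.sum, ← Finset.add_sum_erase _ _ (Finsupp.mem_support_iff.mpr h0)]
    simp [hSdef]
  -- Multiply the relation by D^K n and replace each n·exp by its approximation p·g: the integer N
  -- is minus the total error, hence 0, yet it is not divisible by p.
  set N : ℤ := D ^ K * n * H 0 + p * m with hN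
  have hNC : (N : ℂ) = -∑ x ∈ S, (H x : ℂ) * (D : ℂ) ^ K *
      (n • Complex.exp (φ x) - p • aeval (φ x) g) := by
    have e : ∑ x ∈ S, (H x : ℂ) * (D : ℂ) ^ K * (n • Complex.exp (φ x) - p • aeval (φ x) g)
        = (D : ℂ) ^ K * n * (∑ x ∈ S, (H x : ℂ) * Complex.exp (φ x))
          - p * ∑ x ∈ S, (H x : ℂ) * ((D : ℂ) ^ K * aeval (φ x) g) := by
      rw [Finset.mul_sum, Finset.mul_sum, ← Finset.sum_sub_distrib]
      refine Finset.sum_congr rfl fun x _ => ?_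
      simp only [zsmul_eq_mul, nsmul_eq_mul]
      ring
    rw [e, ← hmC, hN]
    push_cast
    linear_combination (D : ℂ) ^ K * n * hsplit
  have hfne : f ≠ 0 := by
    rintro rfl
    simp at hf0
  have hbound : |(N : ℝ)| ≤ B * ((|(D : ℝ)| ^ d * c) ^ p / (p - 1).factorial) := by
    have h1 : |(N : ℝ)| = ‖(N : ℂ)‖ := by rw [Complex.norm_intCast]
    rw [h1, hNC, norm_neg]
    refine (norm_sum_le _ _).trans ?_
    rw [Finset.sum_mul]
    refine Finset.sum_le_sum fun x hx => ?_
    have hr : φ x ∈ f.aroots ℂ := by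
      rw [mem_aroots]
      refine ⟨hfne, ?_⟩
      have h : aeval (φ x) f = φ (aeval x f) := aeval_algHom_apply φ.toIntAlgHom x f
      rw [h, hfS x hx, map_zero]
    rw [norm_mul, norm_mul, norm_pow, Complex.norm_intCast, Complex.norm_intCast, mul_assoc]
    refine mul_le_mul_of_nonneg_left ?_ (abs_nonneg _)
    have h2 : (|(D : ℝ)| ^ d * c) ^ p / (p - 1).factorial
        = |(D : ℝ)| ^ K * (c ^ p / (p - 1).factorial) := by
      rw [mul_pow, ← pow_mul, mul_comm d p, mul_div_assoc]
    rw [h2]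
    exact mul_le_mul_of_nonneg_left (happ hr) (by positivity)
  have hNlt : |(N : ℝ)| < 1 := hbound.trans_lt (hp₀ p (by omega))
  have hN0 : N = 0 := by
    rw [← Int.cast_abs] at hNlt
    exact Int.abs_lt_one_iff.mp (by exact_mod_cast hNlt)
  have hpI : Prime (p : ℤ) := Nat.prime_iff_prime_int.mp hpp
  have hdvd : (p : ℤ) ∣ D ^ K * n * H 0 :=
    ⟨-m, by linear_combination hN.symm.trans hN0⟩
  have hsmall : ∀ z : ℤ, z ≠ 0 → z.natAbs < p → ¬ (p : ℤ) ∣ z := fun z hz hlt h =>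
    absurd (Nat.le_of_dvd (Int.natAbs_pos.mpr hz) (Int.natCast_dvd.mp h)) (by omega)
  rcases hpI.dvd_or_dvd hdvd with h | h
  · rcases hpI.dvd_or_dvd h with h | h
    · exact hsmall D hD0 (by omega) (hpI.dvd_of_dvd_pow h)
    · exact hn h
  · exact hsmall _ h0 (by omega) h

-- In characteristic zero the exponents j • x are distinct, so no coefficients of `P` merge.
open AddMonoidAlgebra in
theorem aeval_single_ne_zero {L : Type*} [Field L] [CharZero L] {x : L} (hx : x ≠ 0)
    {P : Polynomial ℤ} (hP : P ≠ 0) :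
    Polynomial.aeval (single x 1 : AddMonoidAlgebra ℤ L) P ≠ 0 := by
  classical
  obtain ⟨j, hj⟩ : ∃ j, P.coeff j ≠ 0 := by
    by_contra! h
    exact hP (Polynomial.ext h)
  intro h
  apply hj
  have h1 : (Polynomial.aeval (single x 1 : AddMonoidAlgebra ℤ L) P).coeff (j • x) = P.coeff j := by
    rw [Polynomial.aeval_eq_sum_range]
    simp only [single_pow, one_pow, coeff_sum, coeff_smul, coeff_single, Finsupp.coe_finsetSum,
      Finset.sum_apply, Finsupp.smul_apply, Finsupp.single_apply, nsmul_eq_mul,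
      mul_left_inj' hx, Nat.cast_inj]
    simp only [smul_eq_mul, mul_ite, mul_one, mul_zero, Finset.sum_ite_eq', Finset.mem_range,
      ite_eq_left_iff, not_lt]
    intro hlt
    exact (Polynomial.coeff_eq_zero_of_natDegree_lt (by omega)).symm
  rw [← h1, h]
  rfl

-- The coefficient is the sum of the squares of the coefficients of `F`.
open AddMonoidAlgebra in
theorem coeff_mul_mapDomain_neg_zero {L : Type*} [AddCommGroup L] {F : AddMonoidAlgebra ℤ L}
    (hF : F ≠ 0) :
    (F * mapDomainRingHom ℤ (-AddMonoidHom.id L) F).coeff 0 ≠ 0 := by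
  classical
  have hneg : Function.Injective (-AddMonoidHom.id L : L →+ L) := fun x y h => by simpa using h
  have hval : ∀ x, (mapDomainRingHom ℤ (-AddMonoidHom.id L) F).coeff (-x) = F.coeff x := by
    intro x
    exact Finsupp.mapDomain_apply hneg F.coeff x
  have key : (F * mapDomainRingHom ℤ (-AddMonoidHom.id L) F).coeff 0
      = ∑ x ∈ F.coeff.support, F.coeff x * F.coeff x := by
    rw [coeff_mul, Finsupp.sum]
    refine Finset.sum_congr rfl fun x _ => ?_
    simp only [add_eq_zero_iff_eq_neg']
    rw [Finsupp.sum, Finset.sum_ite_eq', hval]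
    split_ifs with h
    · rfl
    · rw [Finsupp.notMem_support_iff, hval] at h
      rw [h, mul_zero]
  rw [key]
  obtain ⟨x, hx⟩ : ∃ x, F.coeff x ≠ 0 := by
    by_contra! h
    exact hF (by ext x; exact h x)
  exact (Finset.sum_pos' (fun y _ => mul_self_nonneg _)
    ⟨x, Finsupp.mem_support_iff.mpr hx, mul_self_pos.mpr hx⟩).ne'

open AddMonoidAlgebra in
/-- **Hermite–Lindemann theorem** for a Galois number field embedded in `ℂ`. -/
theorem aeval_exp_ne_zero_of_galois {L : Type*} [Field L] [NumberField L] [IsGalois ℚ L]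
    (φ : L →+* ℂ) {x : L} (hx : x ≠ 0) {P : Polynomial ℤ} (hP : P ≠ 0) :
    Polynomial.aeval (Complex.exp (φ x)) P ≠ 0 := by
  classical
  intro hzero
  let E : AddMonoidAlgebra ℤ L →ₐ[ℤ] ℂ := AddMonoidAlgebra.lift ℤ ℂ L
    { toFun := fun y => Complex.exp (φ y.toAdd)
      map_one' := by simp
      map_mul' := fun y z => by simp [Complex.exp_add] }
  have hE : ∀ F : AddMonoidAlgebra ℤ L,
      E F = F.coeff.sum fun y w => (w : ℂ) * Complex.exp (φ y) := by
    intro F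
    simp [E, AddMonoidAlgebra.lift_apply]
  let M (σ : L ≃ₐ[ℚ] L) : AddMonoidAlgebra ℤ L →+* AddMonoidAlgebra ℤ L :=
    mapDomainRingHom ℤ ((σ : L →+* L) : L →+ L)
  let Q (σ : L ≃ₐ[ℚ] L) : AddMonoidAlgebra ℤ L := Polynomial.aeval (single (σ x) 1) P
  -- The product over all conjugates is Galois invariant, and its factor at σ = 1 evaluates to 0.
  -- Multiplying by `ν F` gives the exponent 0 a nonzero coefficient.
  let F : AddMonoidAlgebra ℤ L := ∏ σ : L ≃ₐ[ℚ] L, Q σ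
  let ν : AddMonoidAlgebra ℤ L →+* AddMonoidAlgebra ℤ L :=
    mapDomainRingHom ℤ (-AddMonoidHom.id L)
  have hMQ : ∀ σ τ, M σ (Q τ) = Q (σ * τ) := by
    intro σ τ
    have h : M σ (single (τ x) 1) = single ((σ * τ) x) 1 := by simp [M]
    simp only [Q, Polynomial.aeval_def, Polynomial.hom_eval₂, h]
    congr 1
    exact RingHom.ext_int _ _
  have hMF : ∀ σ, M σ F = F := by
    intro σ
    rw [map_prod]
    exact Fintype.prod_equiv (Equiv.mulLeft σ) _ _ fun τ => hMQ σ τ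
  have hMν : ∀ σ, M σ (ν F) = ν F := by
    intro σ
    have h : (M σ).comp ν = ν.comp (M σ) := by
      simp only [M, ν, ← mapDomainRingHom_comp]
      congr 1
      ext y
      simp
    conv_rhs => rw [← hMF σ]
    exact congrArg (fun g : AddMonoidAlgebra ℤ L →+* AddMonoidAlgebra ℤ L => g F) h
  have hF : F ≠ 0 := Finset.prod_ne_zero_iff.mpr fun σ _ =>
    aeval_single_ne_zero ((map_ne_zero_iff σ σ.injective).mpr hx) hP
  have hEF : E F = 0 := by
    rw [map_prod]
    refine Finset.prod_eq_zero (Finset.mem_univ 1) ?_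
    have h := Polynomial.aeval_algHom_apply E (single x 1) P
    refine h.symm.trans ?_
    rw [hE]
    simpa using hzero
  refine sum_mul_exp_ne_zero_of_galois_invariant φ (F * ν F).coeff
    (coeff_mul_mapDomain_neg_zero hF) ?_ ?_
  · intro σ y
    have h : M σ (F * ν F) = F * ν F := by rw [map_mul, hMF, hMν]
    conv_lhs => rw [← h]
    exact Finsupp.mapDomain_apply σ.injective _ y
  · rw [← hE, map_mul, hEF, zero_mul]

/-- **Hermite–Lindemann theorem**: the exponential of a nonzero algebraic number is
transcendental. -/
theorem transcendental_exp_of_isAlgebraic {a : ℂ} (ha : IsAlgebraic ℚ a) (ha0 : a ≠ 0) :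
    Transcendental ℚ (Complex.exp a) := by
  intro hexp
  obtain ⟨P, hP, hP0⟩ := (IsFractionRing.isAlgebraic_iff ℤ ℚ ℂ).mpr hexp
  have : FiniteDimensional ℚ (IntermediateField.adjoin ℚ {a}) :=
    IntermediateField.adjoin.finiteDimensional ha.isIntegral
  let L := IntermediateField.normalClosure ℚ (IntermediateField.adjoin ℚ {a}) ℂ
  have : NumberField L := ⟨⟩
  have : Normal ℚ L :=
    (Algebra.IsAlgebraic.isNormalClosure_normalClosure (F := ℚ)
      (K := IntermediateField.adjoin ℚ {a}) fun _ => IsAlgClosed.splits _).normal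
  have : IsGalois ℚ L := ⟨⟩
  have hmem : a ∈ L := IntermediateField.le_normalClosure _
    (IntermediateField.mem_adjoin_simple_self ℚ a)
  exact aeval_exp_ne_zero_of_galois (algebraMap L ℂ) (x := ⟨a, hmem⟩)
    (fun h => ha0 (congrArg Subtype.val h)) hP hP0

/-! ### Commensurable solutions of tan θ = θ. -/

/-- Two commensurable nonzero numbers cannot both solve `tan θ = θ`, unless they agree up to
sign. -/
theorem eq_of_sin_eq_mul_cos {β : ℝ} (hβ : β ≠ 0) {k m : ℕ} (hk : 0 < k) (hm : 0 < m)
    (hsk : Real.sin (k * β) = k * β * Real.cos (k * β))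
    (hsm : Real.sin (m * β) = m * β * Real.cos (m * β)) : k = m := by
  by_contra hkm
  set z : ℂ := Complex.exp (2 * (β * Complex.I)) with hz
  have key : ∀ j : ℕ, Real.sin (j * β) = j * β * Real.cos (j * β) →
      z ^ j - 1 = j * (β * Complex.I) * (z ^ j + 1) := by
    intro j hj
    have hj' : Complex.sin (j * β) = j * β * Complex.cos (j * β) := by exact_mod_cast hj
    have e1 : z ^ j = Complex.exp (j * β * Complex.I) * Complex.exp (j * β * Complex.I) := by
      rw [hz, ← Complex.exp_nat_mul, ← Complex.exp_add]
      congr 1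
      ring
    have e2 : Complex.exp (j * β * Complex.I) * Complex.exp (-(j * β) * Complex.I) = 1 := by
      rw [← Complex.exp_add, neg_mul, add_neg_cancel, Complex.exp_zero]
    rw [Complex.sin, Complex.cos] at hj'
    set u := Complex.exp (j * β * Complex.I)
    set v := Complex.exp (-(j * β) * Complex.I)
    rw [e1]
    linear_combination (2 * Complex.I * u) * hj' + (j * β * Complex.I + 1) * e2
      - (u * v - u ^ 2) * Complex.I_sq
  have h1 := key k hsk
  have h2 := key m hsm
  have hkm' : (m : ℤ) - k ≠ 0 := by omega
  have hzalg : IsAlgebraic ℤ z := by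
    -- Eliminating β from the relations for k and m leaves a polynomial equation for z, with
    -- constant term k - m ≠ 0.
    let P : Polynomial ℤ := (m : Polynomial ℤ) * (Polynomial.X ^ k - 1) * (Polynomial.X ^ m + 1)
      - (k : Polynomial ℤ) * (Polynomial.X ^ m - 1) * (Polynomial.X ^ k + 1)
    refine ⟨P, fun hP => ?_, ?_⟩
    · have h0 := congrArg (Polynomial.eval 0) hP
      simp [P, hk.ne', hm.ne'] at h0
      omega
    · simp only [P, map_sub, map_mul, map_add, map_pow, Polynomial.aeval_X, map_one, map_natCast]
      rw [h1, h2]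
      ring
  have hne : z ^ k + 1 ≠ 0 := by
    intro h
    rw [h, mul_zero] at h1
    have : (2 : ℂ) = 0 := by linear_combination h - h1
    norm_num at this
  have hzQ : IsAlgebraic ℚ z := (IsFractionRing.isAlgebraic_iff ℤ ℚ ℂ).mp hzalg
  have hkC : (k : ℂ) ≠ 0 := by exact_mod_cast hk.ne'
  have hβalg : IsAlgebraic ℚ (2 * (β * Complex.I)) := by
    have e : 2 * (β * Complex.I) = 2 * ((z ^ k - 1) * ((k : ℂ) * (z ^ k + 1))⁻¹) := by
      rw [h1]
      field_simp
    rw [e]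
    have hn : ∀ n : ℕ, IsAlgebraic ℚ (n : ℂ) := fun n => isAlgebraic_natCast n
    exact (hn 2).mul (((hzQ.pow k).sub isAlgebraic_one).mul
      ((hn k).mul ((hzQ.pow k).add isAlgebraic_one)).inv)
  refine transcendental_exp_of_isAlgebraic hβalg ?_ hzQ
  simp [hβ]

/-! ### Fourier analysis of the criticality equation. -/

open Complex in
theorem integral_exp_mul_comp_add {T : ℝ} {h : ℝ → ℂ} (hper : Function.Periodic h T) {l : ℂ}
    (hl : exp (l * T) = 1) (s : ℝ) :
    ∫ x in (0 : ℝ)..T, exp (l * x) * h (x + s)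
      = exp (-(l * s)) * ∫ x in (0 : ℝ)..T, exp (l * x) * h x := by
  have hk : Function.Periodic (fun x : ℝ => exp (l * x) * h x) T := by
    intro x
    simp only [hper x]
    rw [ofReal_add, mul_add, exp_add, hl, mul_one]
  have h1 : ∀ x : ℝ, exp (l * x) * h (x + s)
      = exp (-(l * s)) * (fun y : ℝ => exp (l * y) * h y) (x + s) := by
    intro x
    simp only
    rw [← mul_assoc, ← exp_add]
    congr 2
    push_cast
    ring
  simp_rw [h1]
  rw [intervalIntegral.integral_const_mul,
    intervalIntegral.integral_comp_add_right (fun y : ℝ => exp (l * y) * h y) s, zero_add, add_comm,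
    hk.intervalIntegral_add_eq s 0, zero_add]

open Complex in
/-- Fourier coefficients of a periodic function whose symmetric means of radius `γ` are
critical: only the frequencies with `tan (ω γ) = ω γ` can occur. -/
theorem integral_exp_mul_eq_zero_of_critical {T γ : ℝ} {h : ℝ → ℂ} (hc : Continuous h)
    (hper : Function.Periodic h T)
    (hcrit : ∀ x, γ * (h (x + γ) + h (x - γ)) = ∫ z in (x - γ)..(x + γ), h z)
    {w : ℝ} (hw : exp (-(w * I) * T) = 1)
    (hne : Real.sin (w * γ) ≠ w * γ * Real.cos (w * γ)) :
    ∫ x in (0 : ℝ)..T, exp (-(w * I) * x) * h x = 0 := by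
  set l : ℂ := -(w * I) with hl
  set c := ∫ x in (0 : ℝ)..T, exp (l * x) * h x with hcdef
  have hplus := integral_exp_mul_comp_add hper hw γ
  have hminus := integral_exp_mul_comp_add hper hw (-γ)
  simp only [← sub_eq_add_neg] at hminus
  rw [← hcdef] at hplus hminus
  set H : ℝ → ℂ := fun x => ∫ z in (x - γ)..(x + γ), h z with hH
  have hint : ∀ a b : ℝ, IntervalIntegrable h MeasureTheory.volume a b :=
    fun a b => hc.intervalIntegrable a b
  have hHeq : H = fun x => (∫ z in (0 : ℝ)..(x + γ), h z) - ∫ z in (0 : ℝ)..(x - γ), h z := by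
    funext x
    exact (intervalIntegral.integral_interval_sub_left (hint _ _) (hint _ _)).symm
  have hderivH : ∀ x, HasDerivAt H (h (x + γ) - h (x - γ)) x := by
    intro x
    rw [hHeq]
    have hG : ∀ y, HasDerivAt (fun y => ∫ z in (0 : ℝ)..y, h z) (h y) y := fun y =>
      intervalIntegral.integral_hasDerivAt_right (hint _ _)
        hc.aestronglyMeasurable.stronglyMeasurableAtFilter hc.continuousAt
    exact ((hG (x + γ)).comp_add_const x γ).sub ((hG (x - γ)).comp_sub_const x γ)
  have hderivE : ∀ x : ℝ, HasDerivAt (fun x : ℝ => exp (l * x)) (exp (l * x) * l) x := by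
    intro x
    have h1 : HasDerivAt (fun x : ℝ => l * (x : ℂ)) l x := by
      simpa using (ofRealCLM.hasDerivAt (x := x)).const_mul l
    exact h1.cexp
  have hHper : H T = H 0 := by
    have h0 := hcrit 0
    have hT := hcrit T
    have e1 : h (T + γ) = h (0 + γ) := by rw [add_comm, hper, zero_add]
    have e2 : h (T - γ) = h (0 - γ) := by rw [sub_eq_neg_add, hper, zero_sub]
    rw [e1, e2] at hT
    exact hT.symm.trans h0
  -- On the left, H' is a difference of translates and gives 2i sin(wγ)·c; on the right, criticality
  -- turns H into a sum of translates and gives 2i wγ cos(wγ)·c.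
  have hparts := intervalIntegral.integral_mul_deriv_eq_deriv_mul (a := 0) (b := T)
    (fun x _ => hderivE x) (fun x _ => hderivH x)
    (Continuous.intervalIntegrable (by fun_prop) _ _)
    (Continuous.intervalIntegrable (by fun_prop) _ _)
  rw [hHper, hw] at hparts
  have hi1 : IntervalIntegrable (fun x : ℝ => exp (l * x) * h (x + γ)) MeasureTheory.volume 0 T :=
    Continuous.intervalIntegrable (by fun_prop) _ _
  have hi2 : IntervalIntegrable (fun x : ℝ => exp (l * x) * h (x - γ)) MeasureTheory.volume 0 T :=
    Continuous.intervalIntegrable (by fun_prop) _ _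
  have hleft : ∫ x in (0 : ℝ)..T, exp (l * x) * (h (x + γ) - h (x - γ))
      = exp (-(l * γ)) * c - exp (-(l * (-γ : ℝ))) * c := by
    simp_rw [mul_sub]
    rw [intervalIntegral.integral_sub hi1 hi2, hplus, hminus]
  have hright : ∫ x in (0 : ℝ)..T, exp (l * x) * l * H x
      = l * γ * (exp (-(l * γ)) * c + exp (-(l * (-γ : ℝ))) * c) := by
    rw [← hplus, ← hminus, ← intervalIntegral.integral_add hi1 hi2,
      ← intervalIntegral.integral_const_mul]
    refine intervalIntegral.integral_congr fun x _ => ?_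
    simp only [hH, ← hcrit x]
    ring
  rw [hleft, hright] at hparts
  have e1 : exp (-(l * γ)) = cos (w * γ) + sin (w * γ) * I := by
    rw [← exp_mul_I, hl]
    congr 1
    ring
  have e2 : exp (-(l * (-γ : ℝ))) = cos (w * γ) - sin (w * γ) * I := by
    have h := exp_mul_I (-(w * γ : ℂ))
    rw [cos_neg, sin_neg, neg_mul (sin _), ← sub_eq_add_neg] at h
    rw [← h, hl]
    congr 1
    push_cast
    ring
  rw [e1, e2] at hparts
  have hne' : (sin (w * γ) - w * γ * cos (w * γ) : ℂ) ≠ 0 := by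
    rw [sub_ne_zero]
    exact_mod_cast hne
  have hfin : 2 * I * (sin (w * γ) - w * γ * cos (w * γ)) * c = 0 := by
    rw [hl] at hparts
    simp only [ofReal_zero, mul_zero, exp_zero] at hparts
    linear_combination hparts
  simpa [hne'] using hfin

theorem exists_amplitude_phase (p q : ℝ) :
    ∃ b d : ℝ, ∀ y : ℝ, p * Real.cos y + q * Real.sin y = b * Real.sin (y + d) := by
  refine ⟨‖(⟨q, p⟩ : ℂ)‖, Complex.arg ⟨q, p⟩, fun y => ?_⟩
  have h1 := Complex.norm_mul_cos_arg ⟨q, p⟩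
  have h2 := Complex.norm_mul_sin_arg ⟨q, p⟩
  simp only at h1 h2
  rw [Real.sin_add]
  linear_combination -Real.sin y * h1 - Real.cos y * h2

theorem exists_sin_of_fourier_support {T : ℝ} (hT : 0 < T) {f : ℝ → ℝ} (hf : Continuous f)
    (hper : Function.Periodic f T) {k : ℕ} (hk : 0 < k)
    (hzero : ∀ n : ℤ, n ≠ 0 → n.natAbs ≠ k →
      ∫ x in (0 : ℝ)..T, Complex.exp (-((2 * Real.pi * n / T : ℝ) * Complex.I) * x) * f x = 0) :
    ∃ a b c d : ℝ, ∀ x, f x = a + b * Real.sin (c * x + d) := by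
  have : Fact (0 < T) := ⟨hT⟩
  have hperC : Function.Periodic (fun x => (f x : ℂ)) T := fun x => by simp only [hper x]
  let g : C(AddCircle T, ℂ) := ⟨hperC.lift, continuous_coinduced_dom.mpr
    (Complex.continuous_ofReal.comp hf)⟩
  have hg : ∀ x : ℝ, g x = f x := fun x => rfl
  have hcoeff : ∀ n : ℤ, n ∉ ({0, (k : ℤ), -(k : ℤ)} : Finset ℤ) → fourierCoeff g n = 0 := by
    intro n hn
    simp only [Finset.mem_insert, Finset.mem_singleton, not_or] at hn
    rw [fourierCoeff_eq_intervalIntegral g n 0, zero_add]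
    have h := hzero n hn.1 (by omega)
    rw [← h.symm.trans (intervalIntegral.integral_congr fun x _ => ?_), smul_zero]
    simp only [hg, smul_eq_mul, fourier_coe_apply]
    congr 2
    push_cast
    ring
  set s : Finset ℤ := {0, (k : ℤ), -(k : ℤ)} with hs
  have hsum := has_pointwise_sum_fourier_series_of_summable (f := g)
    (summable_of_ne_finset_zero hcoeff)
  have hfx : ∀ x : ℝ, (f x : ℂ) = ∑ n ∈ s, fourierCoeff g n * fourier n (x : AddCircle T) :=
    fun x => (hsum x).unique (hasSum_sum_of_ne_finset_zero fun n hn => by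
      rw [hcoeff n hn, zero_smul])
  have hre : ∀ (n : ℤ) (x : ℝ), (fourierCoeff g n * fourier n (x : AddCircle T)).re
      = (fourierCoeff g n).re * Real.cos (2 * Real.pi * n / T * x)
        - (fourierCoeff g n).im * Real.sin (2 * Real.pi * n / T * x) := by
    intro n x
    have e : fourier n (x : AddCircle T)
        = Complex.exp ((2 * Real.pi * n / T * x : ℝ) * Complex.I) := by
      rw [fourier_coe_apply]
      congr 1
      push_cast
      ring
    rw [e, Complex.mul_re, Complex.exp_ofReal_mul_I_re, Complex.exp_ofReal_mul_I_im]
  obtain ⟨b, d, hbd⟩ := exists_amplitude_phase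
    ((fourierCoeff g k).re + (fourierCoeff g (-k)).re)
    (-(fourierCoeff g k).im + (fourierCoeff g (-k)).im)
  refine ⟨(fourierCoeff g 0).re, b, 2 * Real.pi * k / T, d, fun x => ?_⟩
  rw [← hbd]
  have h := congrArg Complex.re (hfx x)
  rw [Complex.ofReal_re, hs, Finset.sum_insert (by simp; omega), Finset.sum_insert (by simp; omega),
    Finset.sum_singleton, Complex.add_re, Complex.add_re, hre, hre, hre] at h
  have e : 2 * Real.pi * ((-(k : ℤ) : ℤ) : ℝ) / T * x = -(2 * Real.pi * k / T * x) := by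
    push_cast
    ring
  rw [h, e, Real.cos_neg, Real.sin_neg]
  simp only [Int.cast_zero, Int.cast_natCast, mul_zero, zero_div, zero_mul, Real.cos_zero,
    Real.sin_zero]
  ring

theorem exists_sin_of_critical {T : ℝ} (hT : 0 < T) {f : ℝ → ℝ} (hf : Continuous f)
    (hper : Function.Periodic f T) {γ : ℝ} (hγ : 0 < γ)
    (hcrit : ∀ x, γ * (f (x + γ) + f (x - γ)) = ∫ z in (x - γ)..(x + γ), f z) :
    ∃ a b c d : ℝ, ∀ x, f x = a + b * Real.sin (c * x + d) := by
  set β : ℝ := 2 * Real.pi / T * γ with hβ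
  have hβ0 : β ≠ 0 := by positivity
  let c (n : ℤ) : ℂ :=
    ∫ x in (0 : ℝ)..T, Complex.exp (-((2 * Real.pi * n / T : ℝ) * Complex.I) * x) * f x
  have hc : ∀ n : ℤ, c n ≠ 0 →
      Real.sin (n.natAbs * β) = n.natAbs * β * Real.cos (n.natAbs * β) := by
    intro n hn
    have h : Real.sin (2 * Real.pi * n / T * γ)
        = 2 * Real.pi * n / T * γ * Real.cos (2 * Real.pi * n / T * γ) := by
      by_contra hne
      refine hn (integral_exp_mul_eq_zero_of_critical (Complex.continuous_ofReal.comp hf)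
        (fun x => by simp only [Function.comp_apply, hper x]) (fun x => ?_) ?_ hne)
      · rw [show (Complex.ofReal ∘ f) = fun x => (f x : ℂ) from rfl,
          intervalIntegral.integral_ofReal, ← hcrit x]
        push_cast
        ring
      · rw [Complex.exp_eq_one_iff]
        refine ⟨-n, ?_⟩
        push_cast
        have : (T : ℂ) ≠ 0 := by exact_mod_cast hT.ne'
        field_simp
    have e : 2 * Real.pi * n / T * γ = n * β := by rw [hβ]; ring
    rw [e] at h
    -- Both sides of the equation are odd in n.
    rcases Int.natAbs_eq n with h' | h'
    · rw [h'] at h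
      simpa using h
    · rw [h'] at h
      simpa using h
  by_cases hex : ∃ n : ℤ, n ≠ 0 ∧ c n ≠ 0
  · obtain ⟨k, hk0, hk⟩ := hex
    refine exists_sin_of_fourier_support hT hf hper (Int.natAbs_pos.mpr hk0) fun n hn0 hnk => ?_
    by_contra hn
    exact hnk (eq_of_sin_eq_mul_cos hβ0 (Int.natAbs_pos.mpr hn0) (Int.natAbs_pos.mpr hk0)
      (hc n hn) (hc k hk))
  -- Here `f` is constant, and the frequency 1 is an arbitrary choice.
  · push Not at hex
    exact exists_sin_of_fourier_support hT hf hper one_pos fun n hn0 _ => hex n hn0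

/-! ### Averages as functions of the radius, and attainment of the supremum. -/

/-- Rescaling to a fixed interval absorbs the case r = 0 and makes continuity in r evident. -/
theorem intervalAvg_eq_integral (f : ℝ → ℝ) (x r : ℝ) :
    intervalAvg f x r = (1 / 2) * ∫ t in (-1 : ℝ)..1, f (x + r * t) := by
  unfold intervalAvg
  split_ifs with h
  · simp [h]
    ring
  · rw [intervalIntegral.integral_comp_add_mul _ h, smul_eq_mul, mul_neg_one, mul_one,
      ← sub_eq_add_neg]
    field_simp

theorem intervalAvg_zero (f : ℝ → ℝ) (x : ℝ) : intervalAvg f x 0 = f x := by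
  simp [intervalAvg]

theorem intervalAvg_neg (f : ℝ → ℝ) (x r : ℝ) : intervalAvg (-f) x r = -intervalAvg f x r := by
  simp [intervalAvg_eq_integral]

theorem continuous_intervalAvg {f : ℝ → ℝ} (hf : Continuous f) (x : ℝ) :
    Continuous (intervalAvg f x) := by
  have h : intervalAvg f x = fun r => (1 / 2) * ∫ t in (-1 : ℝ)..1, f (x + r * t) :=
    funext (intervalAvg_eq_integral f x)
  rw [h]
  refine continuous_const.mul ?_
  exact intervalIntegral.continuous_parametric_intervalIntegral_of_continuous'
    (f := fun r t => f (x + r * t)) (by fun_prop) _ _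

theorem intervalAvg_le_of_le {f : ℝ → ℝ} (hf : Continuous f) {C : ℝ} (hC : ∀ y, f y ≤ C)
    (x r : ℝ) : intervalAvg f x r ≤ C := by
  rw [intervalAvg_eq_integral]
  have h : ∫ t in (-1 : ℝ)..1, f (x + r * t) ≤ ∫ _ in (-1 : ℝ)..1, C :=
    intervalIntegral.integral_mono_on (by norm_num)
      (Continuous.intervalIntegrable (by fun_prop) _ _) (by simp) fun t _ => hC _
  rw [intervalIntegral.integral_const, smul_eq_mul] at h
  linarith

theorem exists_forall_le_of_periodic {f : ℝ → ℝ} (hf : Continuous f) {T : ℝ} (hT : 0 < T)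
    (hper : Function.Periodic f T) : ∃ x₀, ∀ y, f y ≤ f x₀ := by
  obtain ⟨_, ⟨x₀, rfl⟩, h⟩ := (hper.compact_of_continuous hT.ne' hf).exists_isGreatest
    (Set.range_nonempty f)
  exact ⟨x₀, fun y => h ⟨y, rfl⟩⟩

theorem bddAbove_intervalAvg {f : ℝ → ℝ} (hf : Continuous f) {T : ℝ} (hT : 0 < T)
    (hper : Function.Periodic f T) (x : ℝ) :
    BddAbove (Set.range fun s : Set.Ioi (0 : ℝ) => intervalAvg f x s) := by
  obtain ⟨x₀, h⟩ := exists_forall_le_of_periodic hf hT hper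
  exact ⟨f x₀, by rintro _ ⟨s, rfl⟩; exact intervalAvg_le_of_le hf h x s⟩

theorem intervalAvg_le_iSup {f : ℝ → ℝ} (hf : Continuous f) {T : ℝ} (hT : 0 < T)
    (hper : Function.Periodic f T) (x : ℝ) {r : ℝ} (hr : 0 ≤ r) :
    intervalAvg f x r ≤ ⨆ s : Set.Ioi (0 : ℝ), intervalAvg f x s := by
  have hpos : Set.Ioi (0 : ℝ) ⊆ {r | intervalAvg f x r ≤ ⨆ s : Set.Ioi (0 : ℝ), intervalAvg f x s} :=
    fun r hr => le_ciSup (bddAbove_intervalAvg hf hT hper x) ⟨r, hr⟩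
  have hcl := (isClosed_le (continuous_intervalAvg hf x) continuous_const).closure_subset_iff.mpr hpos
  rw [closure_Ioi] at hcl
  exact hcl hr

theorem mul_intervalAvg {f : ℝ → ℝ} (x : ℝ) {r : ℝ} (hr : 0 < r) :
    2 * r * intervalAvg f x r = ∫ z in (x - r)..(x + r), f z := by
  rw [intervalAvg, if_neg hr.ne']
  field_simp

theorem add_period_mul_intervalAvg {f : ℝ → ℝ} (hf : Continuous f) {T : ℝ} (hT : 0 < T)
    (hper : Function.Periodic f T) (x : ℝ) {r : ℝ} (hr : 0 < r) :
    (r + T) * intervalAvg f x (r + T) = r * intervalAvg f x r + T * intervalAvg f x T := by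
  have hint : ∀ a b : ℝ, IntervalIntegrable f MeasureTheory.volume a b :=
    fun a b => hf.intervalIntegrable a b
  have hmove : ∀ a : ℝ, ∫ z in a..(a + T), f z = ∫ z in x..(x + T), f z :=
    fun a => hper.intervalIntegral_add_eq a x
  have h1 := mul_intervalAvg (f := f) x (add_pos hr hT)
  have h2 := mul_intervalAvg (f := f) x hr
  have h3 := mul_intervalAvg (f := f) x hT
  have i1 := intervalIntegral.integral_add_adjacent_intervals
    (hint (x - (r + T)) (x - (r + T) + T)) (hint _ (x + r))
  have i2 := intervalIntegral.integral_add_adjacent_intervals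
    (hint (x - (r + T)) (x + r)) (hint _ (x + r + T))
  have i3 := intervalIntegral.integral_add_adjacent_intervals (hint (x - T) x) (hint x (x + T))
  have m3 := hmove (x - T)
  rw [sub_add_cancel] at m3
  rw [hmove] at i1 i2
  rw [show x - (r + T) + T = x - r by ring] at i1
  rw [show x + r + T = x + (r + T) by ring] at i2
  linarith

/-- The average at radius r + T is a convex combination of those at r and T, so a maximiser on [0,
T] is global by induction. -/
theorem exists_forall_intervalAvg_le {f : ℝ → ℝ} (hf : Continuous f) {T : ℝ} (hT : 0 < T)
    (hper : Function.Periodic f T) (x : ℝ) :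
    ∃ r₀, 0 ≤ r₀ ∧ ∀ r, 0 ≤ r → intervalAvg f x r ≤ intervalAvg f x r₀ := by
  obtain ⟨r₀, hr₀, hmax⟩ := isCompact_Icc.exists_isMaxOn (Set.nonempty_Icc.mpr hT.le)
    (continuous_intervalAvg hf x).continuousOn
  have hind : ∀ n : ℕ, ∀ r, 0 ≤ r → r ≤ (n + 1) * T → intervalAvg f x r ≤ intervalAvg f x r₀ := by
    intro n
    induction n with
    | zero =>
      intro r h0 h1
      exact hmax ⟨h0, by simpa using h1⟩
    | succ n ih =>
      intro r h0 h1
      rcases le_or_gt r T with h | h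
      · exact hmax ⟨h0, h⟩
      have hr : 0 < r - T := by linarith
      have e := add_period_mul_intervalAvg hf hT hper x hr
      rw [sub_add_cancel] at e
      have b1 := ih (r - T) hr.le (by push_cast at h1; linarith)
      have b2 : intervalAvg f x T ≤ intervalAvg f x r₀ := hmax ⟨hT.le, le_rfl⟩
      have hrpos : 0 < r := by linarith
      refine le_of_mul_le_mul_left ?_ hrpos
      rw [e]
      have c1 := mul_le_mul_of_nonneg_left b1 hr.le
      have c2 := mul_le_mul_of_nonneg_left b2 hT.le
      linarith
  refine ⟨r₀, hr₀.1, fun r hr => ?_⟩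
  obtain ⟨n, hn⟩ := exists_nat_ge (r / T)
  refine hind n r hr ?_
  rw [div_le_iff₀ hT] at hn
  linarith

theorem maxRadius_nonneg (f : ℝ → ℝ) (x : ℝ) : 0 ≤ maxRadius f x :=
  Real.sInf_nonneg fun _ hr => hr.1

/-- The set of maximising radii is closed and nonempty, so it contains its infimum. -/
theorem intervalAvg_le_intervalAvg_maxRadius {f : ℝ → ℝ} (hf : Continuous f) {T : ℝ} (hT : 0 < T)
    (hper : Function.Periodic f T) (x : ℝ) {r : ℝ} (hr : 0 ≤ r) :
    intervalAvg f x r ≤ intervalAvg f x (maxRadius f x) := by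
  obtain ⟨r₀, h0, hmax⟩ := exists_forall_intervalAvg_le hf hT hper x
  have hS : intervalAvg f x r₀ = ⨆ s : Set.Ioi (0 : ℝ), intervalAvg f x s :=
    le_antisymm (intervalAvg_le_iSup hf hT hper x h0) (ciSup_le fun s => hmax s (le_of_lt s.2))
  have hclosed : IsClosed {r : ℝ | 0 ≤ r ∧
      intervalAvg f x r = ⨆ s : Set.Ioi (0 : ℝ), intervalAvg f x s} :=
    isClosed_Ici.inter (isClosed_eq (continuous_intervalAvg hf x) continuous_const)
  have hmem := hclosed.csInf_mem ⟨r₀, h0, hS⟩ ⟨0, fun r hr => hr.1⟩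
  exact (intervalAvg_le_iSup hf hT hper x hr).trans_eq hmem.2.symm

theorem maxRadius_eq_zero {f : ℝ → ℝ} (hf : Continuous f) {T : ℝ} (hT : 0 < T)
    (hper : Function.Periodic f T) {x : ℝ} (h : ∀ s, 0 < s → intervalAvg f x s ≤ f x) :
    maxRadius f x = 0 := by
  have h0 : intervalAvg f x 0 = ⨆ s : Set.Ioi (0 : ℝ), intervalAvg f x s := by
    refine le_antisymm (intervalAvg_le_iSup hf hT hper x le_rfl) (ciSup_le fun s => ?_)
    rw [intervalAvg_zero]
    exact h s s.2
  exact le_antisymm (csInf_le ⟨0, fun r hr => hr.1⟩ ⟨le_rfl, h0⟩) (maxRadius_nonneg f x)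

theorem hasDerivAt_intervalAvg {f : ℝ → ℝ} (hf : Continuous f) (x : ℝ) {γ : ℝ} (hγ : 0 < γ) :
    HasDerivAt (intervalAvg f x)
      ((γ * (f (x + γ) + f (x - γ)) - ∫ z in (x - γ)..(x + γ), f z) / (2 * γ ^ 2)) γ := by
  have hint : ∀ a b : ℝ, IntervalIntegrable f MeasureTheory.volume a b :=
    fun a b => hf.intervalIntegrable a b
  have hG : ∀ y, HasDerivAt (fun y => ∫ z in (0 : ℝ)..y, f z) (f y) y := fun y =>
    intervalIntegral.integral_hasDerivAt_right (hint _ _)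
      hf.aestronglyMeasurable.stronglyMeasurableAtFilter hf.continuousAt
  have hI : HasDerivAt (fun r => ∫ z in (x - r)..(x + r), f z) (f (x + γ) + f (x - γ)) γ := by
    have e : (fun r => ∫ z in (x - r)..(x + r), f z)
        = fun r => (∫ z in (0 : ℝ)..(x + r), f z) - ∫ z in (0 : ℝ)..(x - r), f z :=
      funext fun r => (intervalIntegral.integral_interval_sub_left (hint _ _) (hint _ _)).symm
    rw [e]
    convert! ((hG (x + γ)).comp_const_add x γ).sub ((hG (x - γ)).comp_const_sub x γ) using 1
    ring
  have hquot := hI.div ((hasDerivAt_id γ).const_mul 2) (by simpa using hγ.ne')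
  have heq : intervalAvg f x =ᶠ[nhds γ]
      fun r => (∫ z in (x - r)..(x + r), f z) / (2 * r) := by
    filter_upwards [lt_mem_nhds hγ] with r hr
    rw [eq_div_iff (by positivity), mul_comm, mul_intervalAvg x hr]
  convert! hquot.congr_of_eventuallyEq heq using 1
  simp only [id]
  field_simp

theorem critical_of_isLocalExtr {f : ℝ → ℝ} (hf : Continuous f) (x : ℝ) {γ : ℝ} (hγ : 0 < γ)
    (h : IsLocalExtr (intervalAvg f x) γ) :
    γ * (f (x + γ) + f (x - γ)) = ∫ z in (x - γ)..(x + γ), f z := by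
  have h0 := h.hasDerivAt_eq_zero (hasDerivAt_intervalAvg hf x hγ)
  rw [div_eq_zero_iff] at h0
  rcases h0 with h0 | h0
  · linarith
  · exact absurd h0 (by positivity)

theorem isLocalExtr_intervalAvg {f : ℝ → ℝ} (hf : Continuous f) {T : ℝ} (hT : 0 < T)
    (hper : Function.Periodic f T) {γ : ℝ} (hγ : 0 < γ) {x : ℝ}
    (h1 : maxRadius f x = 0 ∨ maxRadius f x = γ)
    (h2 : maxRadius (-f) x = 0 ∨ maxRadius (-f) x = γ) :
    IsLocalExtr (intervalAvg f x) γ := by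
  have hmax : ∀ r, 0 ≤ r → intervalAvg f x r ≤ intervalAvg f x (maxRadius f x) := fun r hr =>
    intervalAvg_le_intervalAvg_maxRadius hf hT hper x hr
  have hmin : ∀ r, 0 ≤ r → intervalAvg f x (maxRadius (-f) x) ≤ intervalAvg f x r := by
    intro r hr
    have h := intervalAvg_le_intervalAvg_maxRadius (f := -f) hf.neg hT
      (fun y => by simp only [Pi.neg_apply, hper y]) x hr
    rwa [intervalAvg_neg, intervalAvg_neg, neg_le_neg_iff] at h
  have hnhds := lt_mem_nhds hγ
  rcases h1 with h1 | h1
  · rcases h2 with h2 | h2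
    -- Radius 0 is both a maximiser and a minimiser, so the average is constant in r.
    · rw [h1] at hmax
      rw [h2] at hmin
      refine Or.inl ?_
      filter_upwards [hnhds] with r hr
      exact (hmax γ hγ.le).trans (hmin r hr.le)
    · rw [h2] at hmin
      refine Or.inl ?_
      filter_upwards [hnhds] with r hr
      exact hmin r hr.le
  · rw [h1] at hmax
    refine Or.inr ?_
    filter_upwards [hnhds] with r hr
    exact hmax r hr.le

theorem encard_pair_le {X : Type*} (x y : X) : ({x, y} : Set X).encard ≤ 2 :=
  (Set.encard_insert_le _ _).trans_eq (by rw [Set.encard_singleton, one_add_one_eq_two])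

theorem exists_pos_subset_pair {S : Set ℝ} (hS : S.encard ≤ 2) (h0 : 0 ∈ S)
    (hnn : ∀ r ∈ S, 0 ≤ r) : ∃ γ : ℝ, 0 < γ ∧ S ⊆ {0, γ} := by
  by_cases h : ∃ γ ∈ S, γ ≠ 0
  · obtain ⟨γ, hγS, hγ⟩ := h
    refine ⟨γ, (hnn γ hγS).lt_of_ne' hγ, ?_⟩
    have hfin : S.Finite := Set.finite_of_encard_le_coe (k := 2) hS
    have hsub : ({0, γ} : Set ℝ) ⊆ S := Set.insert_subset h0 (Set.singleton_subset_iff.mpr hγS)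
    exact (hfin.eq_of_subset_of_encard_le' hsub
      (hS.trans_eq (Set.encard_pair hγ.symm).symm)).ge
  · push Not at h
    -- Only 0 occurs, so any positive number serves as γ.
    exact ⟨1, one_pos, fun r hr => Or.inl (h r hr)⟩

/-! ### The converse: radii of a sine. -/

theorem intervalAvg_sin {f : ℝ → ℝ} {a b c d : ℝ}
    (hf : ∀ x, f x = a + b * Real.sin (c * x + d)) (x r : ℝ) :
    intervalAvg f x r = a + b * Real.sin (c * x + d) * Real.sinc (c * r) := by
  by_cases hcr : c * r = 0
  · rw [intervalAvg_eq_integral, hcr, Real.sinc_zero]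
    have e : ∀ t : ℝ, f (x + r * t) = f x := by
      intro t
      rw [hf, hf, mul_add, ← mul_assoc, hcr, zero_mul, add_zero]
    simp only [e]
    rw [intervalIntegral.integral_const, smul_eq_mul, hf]
    ring
  · have e : ∫ t in (-1 : ℝ)..1, f (x + r * t)
        = ∫ t in (-1 : ℝ)..1, (a + b * Real.sin ((c * x + d) + (c * r) * t)) := by
      refine intervalIntegral.integral_congr fun t _ => ?_
      simp only [hf]
      congr 3
      ring
    rw [intervalAvg_eq_integral, e]
    generalize c * x + d = y
    generalize c * r = k at hcr
    rw [intervalIntegral.integral_add (by simp)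
      (Continuous.intervalIntegrable (by fun_prop) _ _), intervalIntegral.integral_const_mul,
      intervalIntegral.integral_comp_add_mul _ hcr, integral_sin, Real.sinc_of_ne_zero hcr,
      intervalIntegral.integral_const, mul_neg_one, mul_one, Real.cos_add, Real.cos_add,
      Real.cos_neg, Real.sin_neg, smul_eq_mul, smul_eq_mul]
    field_simp
    ring

/-- The average is a + B sinc(cr). For B ≥ 0 it is largest at r = 0; for B < 0 maximising it means
minimising sinc(cr), a condition on c alone, hence shared by all x and by `-f`. -/
theorem maxRadius_sin_mem_pair {f : ℝ → ℝ} (hfc : Continuous f) {T : ℝ} (hT : 0 < T)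
    (hper : Function.Periodic f T) {a b c d : ℝ}
    (hf : ∀ x, f x = a + b * Real.sin (c * x + d)) (x : ℝ) :
    maxRadius f x ∈ ({0, sInf {r : ℝ | 0 ≤ r ∧
      Real.sinc (c * r) = ⨅ s : Set.Ioi (0 : ℝ), Real.sinc (c * s)}} : Set ℝ) := by
  set B := b * Real.sin (c * x + d) with hB
  have havg : ∀ r, intervalAvg f x r = a + B * Real.sinc (c * r) := intervalAvg_sin hf x
  rcases le_or_gt 0 B with h | h
  · left
    refine maxRadius_eq_zero hfc hT hper fun s _ => ?_
    rw [havg, hf]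
    have := mul_le_mul_of_nonneg_left (Real.sinc_le_one (c * s)) h
    linarith
  · right
    have hbdd : BddAbove (Set.range fun s : Set.Ioi (0 : ℝ) => B * Real.sinc (c * s)) := by
      refine ⟨-B, ?_⟩
      rintro _ ⟨s, rfl⟩
      have := mul_le_mul_of_nonpos_left (Real.neg_one_le_sinc (c * s)) h.le
      simp only
      linarith
    have hsup : (⨆ s : Set.Ioi (0 : ℝ), intervalAvg f x s)
        = a + B * ⨅ s : Set.Ioi (0 : ℝ), Real.sinc (c * s) := by
      simp only [havg]
      rw [← add_ciSup hbdd, Real.mul_iInf_of_nonpos h.le]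
    rw [Set.mem_singleton_iff, maxRadius, hsup]
    congr 1
    ext r
    simp only [Set.mem_ofPred_eq, havg, add_right_inj, mul_right_inj' h.ne]

end MaximalRigidity

open MaximalRigidity in
theorem theorem2 (α : ℝ) (hα : 1 / 2 < α) (f : ℝ → ℝ) (hf : IsCAlpha α f)
    (T : ℝ) (hT : 0 < T) (hper : Function.Periodic f T) :
    (⋃ x : ℝ, ({maxRadius f x, maxRadius (-f) x} : Set ℝ)).encard ≤ 2 ↔
      ∃ a b c d : ℝ, ∀ x : ℝ, f x = a + b * Real.sin (c * x + d) := by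
  have hfc : Continuous f := hf.1.continuous
  constructor
  · intro hcard
    obtain ⟨x₀, hx₀⟩ := exists_forall_le_of_periodic hfc hT hper
    have h0 : maxRadius f x₀ = 0 :=
      maxRadius_eq_zero hfc hT hper fun s _ => intervalAvg_le_of_le hfc hx₀ x₀ s
    obtain ⟨γ, hγ, hsub⟩ := exists_pos_subset_pair hcard
      (Set.mem_iUnion.mpr ⟨x₀, Or.inl h0.symm⟩) (by
        intro r hr
        obtain ⟨x, rfl | rfl⟩ := Set.mem_iUnion.mp hr
        exacts [maxRadius_nonneg _ _, maxRadius_nonneg _ _])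
    refine exists_sin_of_critical hT hfc hper hγ fun x => ?_
    exact critical_of_isLocalExtr hfc x hγ (isLocalExtr_intervalAvg hfc hT hper hγ
      (hsub (Set.mem_iUnion.mpr ⟨x, Or.inl rfl⟩)) (hsub (Set.mem_iUnion.mpr ⟨x, Or.inr rfl⟩)))
  · rintro ⟨a, b, c, d, h⟩
    refine (Set.encard_le_encard (Set.iUnion_subset fun x => ?_)).trans (encard_pair_le 0
      (sInf {r : ℝ | 0 ≤ r ∧ Real.sinc (c * r) = ⨅ s : Set.Ioi (0 : ℝ), Real.sinc (c * s)}))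
    have hneg : ∀ y, (-f) y = -a + -b * Real.sin (c * y + d) := fun y => by
      rw [Pi.neg_apply, h]
      ring
    exact Set.insert_subset (maxRadius_sin_mem_pair hfc hT hper h x)
      (Set.singleton_subset_iff.mpr (maxRadius_sin_mem_pair (f := -f) hfc.neg hT
        (fun y => by simp only [Pi.neg_apply, hper y]) hneg x))
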